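/- **Setting.** Let $(\Omega,\mathcal F,P)$ be a probability space and $\{\mathcal F_n\}_{n\ge0}$ a nondecreasing sequence of sub-$\sigma$-algebras of $\mathcal F$ with $\mathcal F=\sigma(\bigcup_n\mathcal F_n)$ and $\mathcal F_0=\{\emptyset,\Omega\}$. A set $B\in\mathcal F_n$ is an atom of $\mathcal F_n$ if every $A\subset B$ with $A\in\mathcal F_n$ satisfies $P(A)=P(B)$ or $P(A)=0$; $A(\mathcal F_n)$ denotes the set of atoms of $\mathcal F_n$ of positive probability. Assume that each $\mathcal F_n$ is generated by countably many atoms of $\mathcal F_n$. Write $E$ for the expectation and $E_n$ for the conditional expectation given $\mathcal F_n$. Assume that $\{\mathcal F_n\}$ is regular: there is $R\ge2$ such that $f_n\le Rf_{n-1}$ a.s. for all $n\ge1$ and every non-negative martingale $(f_n)_{n\ge0}$ relative to $\{\mathcal F_n\}$. Let $p\in[1,\infty)$ and let $\phi:(0,1]\to(0,\infty)$ satisfy the doubling condition: there is $C>0$ with $\frac1C\le\frac{\phi(r)}{\phi(s)}\le C$ whenever $r,s\in(0,1]$ and $\frac12\le\frac rs\le2$. Assume moreover that there is $C>0$ with $$\int_0^r\phi(t)^p\,dt\le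 C\,r\,\phi(r)^p\quad\text{for all } r\in(0,1].$$ For (real- or complex-valued) $f\in L_1$ put $$\|f\|_{\widetilde{\mathcal L}_{p,\phi}}=\sup_{n\ge0}\ \sup_{B\in A(\mathcal F_n)}\frac1{\phi(P(B))}\left(\frac1{P(B)}\int_B|f-E_nf|^p\,dP\right)^{1/p}+|Ef|,$$ and let $$\widetilde{\mathcal L}_{p,\phi}=\{f\in L_1:\|f\|_{\widetilde{\mathcal L}_{p,\phi}}<\infty\},\qquad \widetilde{\mathcal L}_{p,\phi}(\mathcal F_n)=\{f\in\widetilde{\mathcal L}_{p,\phi}: f\text{ is }\mathcal F_n\text{-measurable}\}.$$ As usual, functions that agree a.s. are identified. An $\mathcal F$-measurable function $g$ is a pointwise multiplier on $\widetilde{\mathcal L}_{p,\phi}$, written $g\in\mathrm{PWM}(\widetilde{\mathcal L}_{p,\phi})$, if $fg\in\widetilde{\mathcal L}_{p,\phi}$ for every $f\in\widetilde{\mathcal L}_{p,\phi}$. Likewise $\mathrm{PWM}(\widetilde{\mathcal L}_{p,\phi}(\mathcal F_n))$ is the set of $\mathcal F_n$-measurable $g$ with $fg\in\widetilde{\mathcal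 L}_{p,\phi}(\mathcal F_n)$ for every $f\in\widetilde{\mathcal L}_{p,\phi}(\mathcal F_n)$, and for such $g$ $$\|g\|_{Op}=\sup\left\{\frac{\|fg\|_{\widetilde{\mathcal L}_{p,\phi}}}{\|f\|_{\widetilde{\mathcal L}_{p,\phi}}}:\ f\in\widetilde{\mathcal L}_{p,\phi}(\mathcal F_n),\ f\not\equiv0\right\}.$$ **Theorem 1.4.** Let $g\in L_1$ and $g_n=E_ng$ for $n\ge0$. 1. If $g\in\mathrm{PWM}(\widetilde{\mathcal L}_{p,\phi})$, then $g_n\in\mathrm{PWM}(\widetilde{\mathcal L}_{p,\phi}(\mathcal F_n))$ for every $n\ge0$. 2. Conversely, if $g_n\in\mathrm{PWM}(\widetilde{\mathcal L}_{p,\phi}(\mathcal F_n))$ for every $n\ge0$ and $\sup_{n\ge0}\|g_n\|_{Op}<\infty$, then $g\in\mathrm{PWM}(\widetilde{\mathcal L}_{p,\phi})$. -/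

import Mathlib

open MeasureTheory
open scoped ENNReal

namespace MartingaleCampanato

variable {Ω : Type*}

/-- `B` is an `(m, P)`-atom: `B ∈ m`, and every `A ⊆ B` with `A ∈ m` satisfies
`P A = P B` or `P A = 0`. -/
def IsAtom (m : MeasurableSpace Ω) {mΩ : MeasurableSpace Ω} (P : Measure Ω) (B : Set Ω) : Prop :=
  MeasurableSet[m] B ∧ ∀ A : Set Ω, MeasurableSet[m] A → A ⊆ B → P A = P B ∨ P A = 0

/-- The σ-algebra `m` is generated by countably many `(m, P)`-atoms. -/
def GeneratedByCountableAtoms (m : MeasurableSpace Ω) {mΩ : MeasurableSpace Ω}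
    (P : Measure Ω) : Prop :=
  ∃ S : Set (Set Ω), S.Countable ∧ (∀ B ∈ S, IsAtom m P B) ∧ m = MeasurableSpace.generateFrom S

/-- The filtration is regular: there is `R ≥ 2` with `f_n ≤ R f_{n-1}` almost surely for every
non-negative martingale `f`. (For `n = 0` the convention `f_{-1} = f_0` makes this trivial.) -/
def IsRegular {mΩ : MeasurableSpace Ω} (ℱ : Filtration ℕ mΩ) (P : Measure Ω) : Prop :=
  ∃ R : ℝ, 2 ≤ R ∧ ∀ f : ℕ → Ω → ℝ, Martingale f ℱ P → (∀ n, 0 ≤ᵐ[P] f n) →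
    ∀ n, ∀ᵐ ω ∂P, f (n + 1) ω ≤ R * f n ω

/-- The doubling condition for a function on `(0, 1]`. -/
def Doubling (φ : ℝ → ℝ) : Prop :=
  ∃ C : ℝ, 0 < C ∧ ∀ r ∈ Set.Ioc (0 : ℝ) 1, ∀ s ∈ Set.Ioc (0 : ℝ) 1,
    1 / 2 ≤ r / s → r / s ≤ 2 → 1 / C ≤ φ r / φ s ∧ φ r / φ s ≤ C

/-- `∫_0^r φ(t)^p dt ≤ C r φ(r)^p` for all `r ∈ (0, 1]`; the integral is taken in `[0, ∞]`, so
that the inequality includes the convergence of the integral. -/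
def IntegralCondition (p : ℝ) (φ : ℝ → ℝ) : Prop :=
  ∃ C : ℝ, 0 < C ∧ ∀ r ∈ Set.Ioc (0 : ℝ) 1,
    ∫⁻ t in Set.Ioc 0 r, ENNReal.ofReal (φ t ^ p) ≤ ENNReal.ofReal (C * r * φ r ^ p)

variable {𝕜 : Type*} [RCLike 𝕜]

/-- The Campanato seminorm, with values in `[0, ∞]`: the supremum over `n ≥ 0` and over the atoms
`B` of `ℱ n` (of positive probability, so that `φ (P B)` makes sense) of
`φ(P B)⁻¹ (P(B)⁻¹ ∫_B |f - E_n f|^p dP)^{1/p}`. -/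
noncomputable def campanatoSeminorm {mΩ : MeasurableSpace Ω} (ℱ : Filtration ℕ mΩ)
    (P : Measure Ω) (p : ℝ) (φ : ℝ → ℝ) (f : Ω → 𝕜) : ℝ≥0∞ :=
  ⨆ (n : ℕ) (B : Set Ω) (_ : IsAtom (ℱ n) P B ∧ 0 < P B),
    ENNReal.ofReal (1 / φ (P.real B)) *
      ((P B)⁻¹ * ∫⁻ ω in B, ‖f ω - (P[f | ℱ n]) ω‖ₑ ^ p ∂P) ^ (1 / p)

/-- The Campanato norm: the Campanato seminorm plus `|E f|`. -/
noncomputable def campanatoNorm {mΩ : MeasurableSpace Ω} (ℱ : Filtration ℕ mΩ)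
    (P : Measure Ω) (p : ℝ) (φ : ℝ → ℝ) (f : Ω → 𝕜) : ℝ≥0∞ :=
  campanatoSeminorm ℱ P p φ f + ‖∫ ω, f ω ∂P‖ₑ

/-- The generalized Campanato space of `m`-measurable functions: the `f ∈ L_1` that are
`m`-measurable (up to almost sure equality, as usual) and have a finite Campanato norm.
For `m = mΩ` it is the whole Campanato space, for `m = ℱ n` it is the subspace of its
`ℱ n`-measurable members. -/
def campanatoSpace (𝕜 : Type*) [RCLike 𝕜] (m : MeasurableSpace Ω)
    {mΩ : MeasurableSpace Ω} (ℱ : Filtration ℕ mΩ) (P : Measure Ω) (p : ℝ) (φ : ℝ → ℝ) : Set (Ω → 𝕜) :=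
  {f | AEStronglyMeasurable[m] f P ∧ Integrable f P ∧ campanatoNorm ℱ P p φ f < ∞}

/-- The pointwise multipliers on the Campanato space of `m`-measurable functions: the `m`-measurable
`g` such that `f g` is in the space for every `f` in the space. -/
def pointwiseMultipliers (𝕜 : Type*) [RCLike 𝕜] (m : MeasurableSpace Ω)
    {mΩ : MeasurableSpace Ω} (ℱ : Filtration ℕ mΩ) (P : Measure Ω) (p : ℝ) (φ : ℝ → ℝ) : Set (Ω → 𝕜) :=
  {g | AEStronglyMeasurable[m] g P ∧
    ∀ f ∈ campanatoSpace 𝕜 m ℱ P p φ, (fun ω => f ω * g ω) ∈ campanatoSpace 𝕜 m ℱ P p φ}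

/-- The operator norm, with values in `[0, ∞]`, of the multiplication by `g` on the Campanato space
of `m`-measurable functions: the supremum of `‖f g‖ / ‖f‖` over the `f` in the space
that are not almost surely zero. -/
noncomputable def multiplierNorm (m : MeasurableSpace Ω) {mΩ : MeasurableSpace Ω}
    (ℱ : Filtration ℕ mΩ) (P : Measure Ω) (p : ℝ) (φ : ℝ → ℝ) (g : Ω → 𝕜) : ℝ≥0∞ :=
  ⨆ (f : Ω → 𝕜) (_ : f ∈ campanatoSpace 𝕜 m ℱ P p φ ∧ ¬ f =ᵐ[P] 0),
    campanatoNorm ℱ P p φ (fun ω => f ω * g ω) / campanatoNorm ℱ P p φ f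

end MartingaleCampanato

open Filter Topology

namespace MartingaleCampanato

variable {Ω : Type*} {𝕜 : Type*} [RCLike 𝕜] {mΩ : MeasurableSpace Ω} {P : Measure Ω}

/-! Both directions rest on `campanatoNorm_condExp_le`: conditioning on `ℱ k` does not increase the
Campanato norm. If `g` is a multiplier and `f` is `ℱ n`-measurable, then `f * E_n g = E_n (f * g)`,
which settles the first direction.

For the converse, `f_n * g_n` tends to `f * g` almost surely by Lévy's theorem, with norms at most
`sup ‖g_n‖_Op * ‖f‖`. It remains to see that bounded norms pass to almost sure limits
(`mem_campanatoSpace_of_tendsto`). Conditional expectations need not follow such a limit, but on an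
atom they are constants: a subsequence of these converges to some `a`, Fatou bounds the distance
from the limit to `a`, and replacing `a` by the conditional expectation costs a factor `2`. -/

/-- The factor in front of the `L^p`-norm on `B` in the Campanato seminorm. -/
noncomputable def atomWeight (P : Measure Ω) (p : ℝ) (φ : ℝ → ℝ) (B : Set Ω) : ℝ≥0∞ :=
  ENNReal.ofReal (1 / φ (P.real B)) * (P B)⁻¹ ^ (1 / p)

theorem atomWeight_mul_eLpNorm {p : ℝ} (hp : 1 ≤ p) (φ : ℝ → ℝ) (B : Set Ω) (u : Ω → 𝕜) :
    atomWeight P p φ B * eLpNorm u (ENNReal.ofReal p) (P.restrict B) =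
      ENNReal.ofReal (1 / φ (P.real B)) *
        ((P B)⁻¹ * ∫⁻ ω in B, ‖u ω‖ₑ ^ p ∂P) ^ (1 / p) := by
  have hp0 : 0 < p := by linarith
  rw [eLpNorm_eq_lintegral_rpow_enorm_toReal (by simpa using hp0) ENNReal.ofReal_ne_top,
    ENNReal.toReal_ofReal hp0.le, ENNReal.mul_rpow_of_nonneg _ _ (by positivity), atomWeight,
    mul_assoc]

theorem campanatoSeminorm_le_iff {ℱ : Filtration ℕ mΩ} {p : ℝ} (hp : 1 ≤ p) {φ : ℝ → ℝ}
    {f : Ω → 𝕜} {N : ℝ≥0∞} :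
    campanatoSeminorm ℱ P p φ f ≤ N ↔ ∀ (n : ℕ) (B : Set Ω), IsAtom (ℱ n) P B → 0 < P B →
      atomWeight P p φ B *
        eLpNorm (f - P[f | ℱ n]) (ENNReal.ofReal p) (P.restrict B) ≤ N := by
  simp only [campanatoSeminorm, iSup_le_iff, and_imp, atomWeight_mul_eLpNorm hp, Pi.sub_apply]

theorem atomWeight_ne_zero [IsFiniteMeasure P] {p : ℝ} (hp : 1 ≤ p) {φ : ℝ → ℝ} {B : Set Ω}
    (hφ : 0 < φ (P.real B)) : atomWeight P p φ B ≠ 0 := by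
  refine mul_ne_zero (by simpa using hφ) ?_
  exact (ENNReal.rpow_pos_of_nonneg (ENNReal.inv_pos.2 (measure_ne_top P B)) (by positivity)).ne'

theorem atomWeight_ne_top {p : ℝ} (hp : 1 ≤ p) {φ : ℝ → ℝ} {B : Set Ω} (hB : 0 < P B) :
    atomWeight P p φ B ≠ ∞ :=
  ENNReal.mul_ne_top ENNReal.ofReal_ne_top
    (ENNReal.rpow_ne_top_of_nonneg (by positivity) (ENNReal.inv_ne_top.2 hB.ne'))

theorem campanatoSeminorm_congr_ae {ℱ : Filtration ℕ mΩ} {p : ℝ} (hp : 1 ≤ p) {φ : ℝ → ℝ}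
    {f g : Ω → 𝕜} (h : f =ᵐ[P] g) :
    campanatoSeminorm ℱ P p φ f = campanatoSeminorm ℱ P p φ g := by
  refine eq_of_forall_ge_iff fun N => ?_
  simp only [campanatoSeminorm_le_iff hp]
  have key : ∀ (n : ℕ) (B : Set Ω),
      eLpNorm (f - P[f | ℱ n]) (ENNReal.ofReal p) (P.restrict B) =
        eLpNorm (g - P[g | ℱ n]) (ENNReal.ofReal p) (P.restrict B) := fun n B =>
    eLpNorm_congr_ae (ae_restrict_of_ae (h.sub (condExp_congr_ae h)))
  simp only [key]

theorem campanatoNorm_congr_ae {ℱ : Filtration ℕ mΩ} {p : ℝ} (hp : 1 ≤ p) {φ : ℝ → ℝ}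
    {f g : Ω → 𝕜} (h : f =ᵐ[P] g) :
    campanatoNorm ℱ P p φ f = campanatoNorm ℱ P p φ g := by
  rw [campanatoNorm, campanatoNorm, campanatoSeminorm_congr_ae hp h, integral_congr_ae h]

/-- The conditional expectation is a contraction of `L^q` on every set that is measurable for the
conditioning σ-algebra. -/
theorem eLpNorm_condExp_restrict_le {m : MeasurableSpace Ω} (hm : m ≤ mΩ) {f : Ω → 𝕜}
    (hf : Integrable f P) {B : Set Ω} (hB : MeasurableSet[m] B) {q : ℝ≥0∞} (hq : 1 ≤ q) :
    eLpNorm (P[f | m]) q (P.restrict B) ≤ eLpNorm f q (P.restrict B) := by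
  -- Since `B` is in `m`, its indicator passes through the conditional expectation, and the global
  -- contraction applies.
  rw [← eLpNorm_indicator_eq_eLpNorm_restrict (hm _ hB),
    ← eLpNorm_indicator_eq_eLpNorm_restrict (hm _ hB),
    ← eLpNorm_congr_ae (condExp_indicator hf hB)]
  exact eLpNorm_condExp_le_eLpNorm _ hq

/-- Up to a factor `2`, the conditional expectation is the best approximation in `L^q` on `B` among
the integrable functions that are measurable for the conditioning σ-algebra. -/
theorem eLpNorm_sub_condExp_restrict_le [IsFiniteMeasure P] {m : MeasurableSpace Ω} (hm : m ≤ mΩ)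
    {f : Ω → 𝕜} (hf : Integrable f P) (c : 𝕜) {B : Set Ω} (hB : MeasurableSet[m] B)
    {q : ℝ≥0∞} (hq : 1 ≤ q) :
    eLpNorm (f - P[f | m]) q (P.restrict B) ≤
      2 * eLpNorm (f - fun _ => c) q (P.restrict B) := by
  have hc : Integrable (fun _ : Ω => c) P := integrable_const c
  have h : f - P[f | m] =ᵐ[P] (f - fun _ => c) - P[f - fun _ => c | m] := by
    filter_upwards [condExp_sub hf hc m] with ω hω
    simp [hω, condExp_const hm]
  rw [eLpNorm_congr_ae (ae_restrict_of_ae h), two_mul]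
  refine (eLpNorm_sub_le (hf.sub hc).aestronglyMeasurable.restrict
    integrable_condExp.aestronglyMeasurable.restrict hq).trans ?_
  gcongr
  exact eLpNorm_condExp_restrict_le hm (hf.sub hc) hB hq

/-- For `n ≤ k` the tower property gives `E_k f - E_n E_k f = E_k (f - E_n f)`, and `E_k` contracts
`L^p` on `B`, which lies in `ℱ n ⊆ ℱ k`. For `n ≥ k` the oscillation vanishes. -/
theorem campanatoSeminorm_condExp_le [IsFiniteMeasure P] (ℱ : Filtration ℕ mΩ) {p : ℝ}
    (hp : 1 ≤ p) (φ : ℝ → ℝ) {f : Ω → 𝕜} (hf : Integrable f P) (k : ℕ) :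
    campanatoSeminorm ℱ P p φ (P[f | ℱ k]) ≤ campanatoSeminorm ℱ P p φ f := by
  rw [campanatoSeminorm_le_iff hp]
  intro n B hB hPB
  rcases le_total n k with hnk | hkn
  · refine le_trans ?_ ((campanatoSeminorm_le_iff hp).1 le_rfl n B hB hPB)
    gcongr
    have h : P[f | ℱ k] - P[P[f | ℱ k] | ℱ n] =ᵐ[P] P[f - P[f | ℱ n] | ℱ k] := by
      filter_upwards [condExp_sub hf (integrable_condExp (f := f) (m := ℱ n)) (ℱ k),
        condExp_condExp_of_le (f := f) (μ := P) (ℱ.mono hnk) (ℱ.le k)] with ω h₁ h₂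
      rw [h₁, Pi.sub_apply, Pi.sub_apply, h₂,
        condExp_of_stronglyMeasurable (ℱ.le k) (stronglyMeasurable_condExp.mono (ℱ.mono hnk))
          integrable_condExp]
    rw [eLpNorm_congr_ae (ae_restrict_of_ae h)]
    exact eLpNorm_condExp_restrict_le (ℱ.le k) (hf.sub integrable_condExp)
      (ℱ.mono hnk _ hB.1) (by simpa using hp)
  · rw [condExp_of_stronglyMeasurable (ℱ.le n) (stronglyMeasurable_condExp.mono (ℱ.mono hkn))
      integrable_condExp]
    simp

theorem campanatoNorm_condExp_le [IsFiniteMeasure P] (ℱ : Filtration ℕ mΩ) {p : ℝ}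
    (hp : 1 ≤ p) (φ : ℝ → ℝ) {f : Ω → 𝕜} (hf : Integrable f P) (k : ℕ) :
    campanatoNorm ℱ P p φ (P[f | ℱ k]) ≤ campanatoNorm ℱ P p φ f := by
  rw [campanatoNorm, campanatoNorm, integral_condExp (ℱ.le k)]
  gcongr
  exact campanatoSeminorm_condExp_le ℱ hp φ hf k

theorem condExp_mem_campanatoSpace [IsFiniteMeasure P] {ℱ : Filtration ℕ mΩ} {p : ℝ}
    (hp : 1 ≤ p) {φ : ℝ → ℝ} {f : Ω → 𝕜} (hf : f ∈ campanatoSpace 𝕜 mΩ ℱ P p φ) (k : ℕ) :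
    P[f | ℱ k] ∈ campanatoSpace 𝕜 (ℱ k) ℱ P p φ :=
  ⟨stronglyMeasurable_condExp.aestronglyMeasurable, integrable_condExp,
    (campanatoNorm_condExp_le ℱ hp φ hf.2.1 k).trans_lt hf.2.2⟩

theorem campanatoSpace_mono {m m' : MeasurableSpace Ω} (h : m ≤ m')
    (ℱ : Filtration ℕ mΩ) (p : ℝ) (φ : ℝ → ℝ) :
    campanatoSpace 𝕜 m ℱ P p φ ⊆ campanatoSpace 𝕜 m' ℱ P p φ :=
  fun _ hf => ⟨hf.1.mono h, hf.2⟩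

/-- The factor `f` can be pulled out of `E_n (f * g)` because the multiplier property already makes
`f * g` integrable. -/
theorem condExp_mem_pointwiseMultipliers [IsFiniteMeasure P] {ℱ : Filtration ℕ mΩ} {p : ℝ}
    (hp : 1 ≤ p) {φ : ℝ → ℝ} {g : Ω → 𝕜} (hg : Integrable g P)
    (hgm : g ∈ pointwiseMultipliers 𝕜 mΩ ℱ P p φ) (n : ℕ) :
    P[g | ℱ n] ∈ pointwiseMultipliers 𝕜 (ℱ n) ℱ P p φ := by
  refine ⟨stronglyMeasurable_condExp.aestronglyMeasurable, fun f hf => ?_⟩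
  have hfg := hgm.2 f (campanatoSpace_mono (ℱ.le n) ℱ p φ hf)
  have h : P[fun ω => f ω * g ω | ℱ n] =ᵐ[P] fun ω => f ω * (P[g | ℱ n]) ω :=
    condExp_bilin_of_aestronglyMeasurable_left (.mul ℝ 𝕜) hf.1 hfg.2.1 hg
  have hmem := condExp_mem_campanatoSpace hp hfg n
  exact ⟨hmem.1.congr h, hmem.2.1.congr h, campanatoNorm_congr_ae hp h ▸ hmem.2.2⟩

/-- A function that is measurable for `m` is almost surely constant on every atom of `m`. -/
theorem IsAtom.exists_ae_eq_const [IsFiniteMeasure P] {m : MeasurableSpace Ω} (hm : m ≤ mΩ)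
    {B : Set Ω} (hB : IsAtom m P B) {u : Ω → 𝕜} (hu : StronglyMeasurable[m] u) :
    ∃ c : 𝕜, u =ᵐ[P.restrict B] fun _ => c := by
  -- Measurable sets separate points countably, so it suffices that `u` lies almost surely in `U` or
  -- almost surely outside it on `B`; this is the atom dichotomy for `B ∩ u ⁻¹' U`.
  refine exists_eventuallyEq_const_of_forall_separating MeasurableSet fun U hU => ?_
  have hA : MeasurableSet[m] (u ⁻¹' U) := hu.measurable hU
  rw [ae_restrict_iff' (hm _ hB.1), ae_restrict_iff' (hm _ hB.1)]
  rcases hB.2 (B ∩ u ⁻¹' U) (hB.1.inter hA) Set.inter_subset_left with h | h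
  · left
    have h0 : P (B \ (u ⁻¹' U)) = 0 := by
      have := measure_inter_add_sdiff (μ := P) B (hm _ hA)
      rw [h] at this
      exact (ENNReal.add_right_inj (measure_ne_top P B)).1 (this.trans (add_zero _).symm)
    filter_upwards [measure_eq_zero_iff_ae_notMem.1 h0] with ω hω hωB
    by_contra hU'
    exact hω ⟨hωB, hU'⟩
  · right
    filter_upwards [measure_eq_zero_iff_ae_notMem.1 h] with ω hω hωB hU'
    exact hω ⟨hωB, hU'⟩

/-- Lévy's upward theorem for real- or complex-valued functions. -/
theorem tendsto_ae_condExp_of_iSup_eq [IsFiniteMeasure P] {ℱ : Filtration ℕ mΩ}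
    (hgen : ⨆ n, ℱ n = mΩ) {f : Ω → 𝕜} (hf : Integrable f P) :
    ∀ᵐ ω ∂P, Tendsto (fun n => (P[f | ℱ n]) ω) atTop (𝓝 (f ω)) := by
  -- Real and imaginary parts commute with conditioning, so the real-valued theorem applies to each.
  have real : ∀ T : 𝕜 →L[ℝ] ℝ,
      ∀ᵐ ω ∂P, Tendsto (fun n => T ((P[f | ℱ n]) ω)) atTop (𝓝 (T (f ω))) := fun T => by
    have hTf : Integrable (T ∘ f) P := T.integrable_comp hf
    have hlim := tendsto_ae_condExp (ℱ := ℱ) (μ := P) (T ∘ f)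
    rw [hgen] at hlim
    have hself : P[T ∘ f | mΩ] =ᵐ[P] T ∘ f :=
      condExp_of_aestronglyMeasurable' le_rfl hTf.aestronglyMeasurable hTf
    have hcomm := ae_all_iff.2 fun n => T.comp_condExp_comm (m := ℱ n) hf
    filter_upwards [hlim, hself, hcomm] with ω h₁ h₂ h₃
    rw [h₂] at h₁
    exact h₁.congr fun n => (h₃ n).symm
  filter_upwards [real RCLike.reCLM, real RCLike.imCLM] with ω h₁ h₂
  have h := ((RCLike.continuous_ofReal (K := 𝕜)).tendsto _).comp h₁ |>.add
    ((((RCLike.continuous_ofReal (K := 𝕜)).tendsto _).comp h₂).mul_const RCLike.I)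
  simpa [Function.comp_def, RCLike.re_add_im] using h

/-- Bounds for the mean oscillation on an atom pass to almost sure limits, up to a factor `2`. -/
theorem eLpNorm_sub_condExp_le_of_tendsto [IsFiniteMeasure P] {m : MeasurableSpace Ω} (hm : m ≤ mΩ)
    {B : Set Ω} (hB : IsAtom m P B) (hPB : 0 < P B) {q : ℝ≥0∞} (hq : 1 ≤ q)
    {h : ℕ → Ω → 𝕜} {h' : Ω → 𝕜}
    (hint : ∀ k, Integrable (h k) P) (hint' : Integrable h' P)
    (hlim : ∀ᵐ ω ∂P, Tendsto (fun k => h k ω) atTop (𝓝 (h' ω)))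
    {S T : ℝ≥0∞} (hS : S ≠ ∞)
    (hbdd : ∀ k, eLpNorm (h k) q (P.restrict B) ≤ S)
    (hosc : ∀ k, eLpNorm (h k - P[h k | m]) q (P.restrict B) ≤ T) :
    eLpNorm (h' - P[h' | m]) q (P.restrict B) ≤ 2 * T := by
  choose c hc using fun k => hB.exists_ae_eq_const hm
    (stronglyMeasurable_condExp (f := h k) (m := m) (μ := P))
  have hν : P.restrict B ≠ 0 := by
    simpa [Measure.restrict_eq_zero] using hPB.ne'
  -- `w` is the `L^q` norm of `1` on `B`. The bound `S` serves only to confine the constants `c k`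
  -- to a ball; it does not enter the conclusion.
  set w : ℝ≥0∞ := (P.restrict B) Set.univ ^ (1 / q.toReal) with hw
  have hw0 : w ≠ 0 := by
    refine (ENNReal.rpow_pos ?_ (measure_ne_top _ _)).ne'
    simpa using hPB
  have hcS : ∀ k, ‖c k‖ₑ ≤ S / w := fun k => by
    rw [ENNReal.le_div_iff_mul_le (Or.inl hw0) (Or.inr hS),
      ← eLpNorm_const (c k) (one_pos.trans_le hq).ne' hν, ← eLpNorm_congr_ae (hc k)]
    exact (eLpNorm_condExp_restrict_le hm (hint k) hB.1 hq).trans (hbdd k)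
  have hSw : S / w ≠ ∞ := ENNReal.div_ne_top hS hw0
  have hcball : ∀ k, c k ∈ Metric.closedBall (0 : 𝕜) (S / w).toReal := fun k => by
    rw [mem_closedBall_zero_iff, ← toReal_enorm]
    exact ENNReal.toReal_mono hSw (hcS k)
  obtain ⟨a, -, s, hs, ha⟩ := tendsto_subseq_of_bounded Metric.isBounded_closedBall hcball
  refine (eLpNorm_sub_condExp_restrict_le hm hint' a hB.1 hq).trans ?_
  gcongr
  refine Lp.eLpNorm_le_of_ae_tendsto (u := atTop) (f := fun k => h (s k) - fun _ => c (s k))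
    (Eventually.of_forall fun k => ?_)
    (fun k => ((hint _).sub (integrable_const _)).aestronglyMeasurable.restrict) ?_
  · refine le_trans (eLpNorm_congr_ae ?_).le (hosc (s k))
    exact EventuallyEq.rfl.sub (hc (s k)).symm
  · filter_upwards [ae_restrict_of_ae hlim] with ω hω
    exact (hω.comp hs.tendsto_atTop).sub ha

theorem campanatoNorm_mul_le_multiplierNorm {m : MeasurableSpace Ω}
    {ℱ : Filtration ℕ mΩ} {p : ℝ} (hp : 1 ≤ p) {φ : ℝ → ℝ} {f g : Ω → 𝕜}
    (hf : f ∈ campanatoSpace 𝕜 m ℱ P p φ) {M : ℝ≥0∞} (hM : M ≠ ∞)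
    (hg : multiplierNorm m ℱ P p φ g ≤ M) :
    campanatoNorm ℱ P p φ (fun ω => f ω * g ω) ≤ M * campanatoNorm ℱ P p φ f := by
  by_cases h0 : f =ᵐ[P] 0
  · have hfg : (fun ω => f ω * g ω) =ᵐ[P] f := by
      filter_upwards [h0] with ω hω
      simp [hω]
    have hz : campanatoNorm ℱ P p φ (0 : Ω → 𝕜) = 0 := by
      have : campanatoSeminorm ℱ P p φ (0 : Ω → 𝕜) ≤ 0 := by
        simp [campanatoSeminorm_le_iff hp]
      simp [campanatoNorm, nonpos_iff_eq_zero.1 this]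
    rw [campanatoNorm_congr_ae hp hfg, campanatoNorm_congr_ae hp h0, hz, mul_zero]
  -- Finiteness of `M` excludes a zero denominator under a nonzero numerator, so definiteness of the
  -- norm is not needed.
  · rw [← ENNReal.div_le_iff_le_mul (Or.inr hM) (Or.inl hf.2.2.ne)]
    exact le_trans (le_iSup₂_of_le f ⟨hf, h0⟩ le_rfl) hg

/-- A function that is the almost sure limit of functions with bounded Campanato norms is in the
Campanato space. -/
theorem mem_campanatoSpace_of_tendsto [IsProbabilityMeasure P] {ℱ : Filtration ℕ mΩ}
    (hzero : ℱ 0 = ⊥) {p : ℝ} (hp : 1 ≤ p) {φ : ℝ → ℝ} (hφ : ∀ r ∈ Set.Ioc (0 : ℝ) 1, 0 < φ r)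
    {h : ℕ → Ω → 𝕜} {h' : Ω → 𝕜} (hint : ∀ k, Integrable (h k) P)
    (hlim : ∀ᵐ ω ∂P, Tendsto (fun k => h k ω) atTop (𝓝 (h' ω)))
    {N : ℝ≥0∞} (hN : N ≠ ∞) (hbdd : ∀ k, campanatoNorm ℱ P p φ (h k) ≤ N) :
    h' ∈ campanatoSpace 𝕜 mΩ ℱ P p φ := by
  set q : ℝ≥0∞ := ENNReal.ofReal p with hq_def
  have hq : 1 ≤ q := by simpa [hq_def] using hp
  have hφP : ∀ B : Set Ω, 0 < P B → 0 < φ (P.real B) := fun B hB =>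
    hφ _ ⟨ENNReal.toReal_pos hB.ne' (measure_ne_top P B), measureReal_le_one⟩
  have hosc : ∀ (n : ℕ) (B : Set Ω), IsAtom (ℱ n) P B → 0 < P B → ∀ k,
      eLpNorm (h k - P[h k | ℱ n]) q (P.restrict B) ≤ N / atomWeight P p φ B := by
    intro n B hB hPB k
    rw [ENNReal.le_div_iff_mul_le (Or.inl (atomWeight_ne_zero hp (hφP B hPB)))
      (Or.inr hN), mul_comm]
    exact (campanatoSeminorm_le_iff hp).1 (le_self_add.trans (hbdd k)) n B hB hPB
  -- At level `0` the whole space is an atom and `E_0` is the mean, so seminorm and mean together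
  -- bound `h k` in `L^p` uniformly in `k`.
  have hΩ : IsAtom (ℱ 0) P Set.univ := by
    refine ⟨MeasurableSet.univ, fun A hA _ => ?_⟩
    rw [hzero, MeasurableSpace.measurableSet_bot_iff] at hA
    rcases hA with rfl | rfl <;> simp
  have hS : ∀ k, eLpNorm (h k) q P ≤ N / atomWeight P p φ Set.univ + N := fun k => by
    have h₁ := hosc 0 Set.univ hΩ (by simp) k
    rw [hzero, condExp_bot, Measure.restrict_univ] at h₁
    have h₂ : eLpNorm (fun _ : Ω => ∫ ω, h k ω ∂P) q P ≤ N := by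
      rw [eLpNorm_const _ (one_pos.trans_le hq).ne' (IsProbabilityMeasure.ne_zero P)]
      simpa using le_add_self.trans (hbdd k)
    calc eLpNorm (h k) q P
        = eLpNorm ((h k - fun _ => ∫ ω, h k ω ∂P) + fun _ => ∫ ω, h k ω ∂P) q P := by
          rw [sub_add_cancel]
      _ ≤ _ := eLpNorm_add_le ((hint k).sub (integrable_const _)).aestronglyMeasurable
          aestronglyMeasurable_const hq
      _ ≤ _ := add_le_add h₁ h₂
  have hStop : N / atomWeight P p φ Set.univ + N ≠ ∞ :=
    ENNReal.add_ne_top.2 ⟨ENNReal.div_ne_top hN (atomWeight_ne_zero hp (hφP _ (by simp))), hN⟩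
  have hmeas : AEStronglyMeasurable h' P :=
    aestronglyMeasurable_of_tendsto_ae atTop (fun k => (hint k).aestronglyMeasurable) hlim
  have hint' : Integrable h' P := by
    refine MemLp.integrable hq ⟨hmeas, lt_of_le_of_lt ?_ hStop.lt_top⟩
    exact Lp.eLpNorm_le_of_ae_tendsto (Eventually.of_forall hS)
      (fun k => (hint k).aestronglyMeasurable) hlim
  refine ⟨hmeas, hint', ENNReal.add_lt_top.2 ⟨?_, enorm_lt_top⟩⟩
  refine lt_of_le_of_lt ((campanatoSeminorm_le_iff (N := 2 * N) hp).2 fun n B hB hPB => ?_)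
    (ENNReal.mul_ne_top ENNReal.ofNat_ne_top hN).lt_top
  have hfin := eLpNorm_sub_condExp_le_of_tendsto (ℱ.le n) hB hPB hq hint hint' hlim hStop
    (fun k => (eLpNorm_mono_measure _ Measure.restrict_le_self).trans (hS k))
    (hosc n B hB hPB)
  calc atomWeight P p φ B * eLpNorm (h' - P[h' | ℱ n]) q (P.restrict B)
      ≤ atomWeight P p φ B * (2 * (N / atomWeight P p φ B)) := by gcongr
    _ = 2 * (atomWeight P p φ B * (N / atomWeight P p φ B)) := by ring
    _ = 2 * N := by
      rw [ENNReal.mul_div_cancel (atomWeight_ne_zero hp (hφP B hPB)) (atomWeight_ne_top hp hPB)]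

/-- Integrability of `f * g` is not known beforehand, so the approximants are the products `f_n *
g_n`, not `E_n (f * g)`. -/
theorem mem_pointwiseMultipliers_of_condExp [IsProbabilityMeasure P] {ℱ : Filtration ℕ mΩ}
    (hgen : ⨆ n, ℱ n = mΩ) (hzero : ℱ 0 = ⊥) {p : ℝ} (hp : 1 ≤ p) {φ : ℝ → ℝ}
    (hφ : ∀ r ∈ Set.Ioc (0 : ℝ) 1, 0 < φ r) {g : Ω → 𝕜} (hg : Integrable g P)
    (hgn : ∀ n, P[g | ℱ n] ∈ pointwiseMultipliers 𝕜 (ℱ n) ℱ P p φ)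
    (hM : ⨆ n, multiplierNorm (ℱ n) ℱ P p φ (P[g | ℱ n]) < ∞) :
    g ∈ pointwiseMultipliers 𝕜 mΩ ℱ P p φ := by
  refine ⟨hg.aestronglyMeasurable, fun f hf => ?_⟩
  have hfn := condExp_mem_campanatoSpace hp hf
  refine mem_campanatoSpace_of_tendsto hzero hp hφ
    (h := fun n ω => (P[f | ℱ n]) ω * (P[g | ℱ n]) ω)
    (fun n => ((hgn n).2 _ (hfn n)).2.1) ?_ (ENNReal.mul_ne_top hM.ne hf.2.2.ne) fun n => ?_
  · filter_upwards [tendsto_ae_condExp_of_iSup_eq hgen hf.2.1,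
      tendsto_ae_condExp_of_iSup_eq hgen hg] with ω h₁ h₂
    exact h₁.mul h₂
  · refine (campanatoNorm_mul_le_multiplierNorm hp (hfn n) hM.ne
      (le_iSup (fun n => multiplierNorm (ℱ n) ℱ P p φ (P[g | ℱ n])) n)).trans ?_
    gcongr
    exact campanatoNorm_condExp_le ℱ hp φ hf.2.1 n

end MartingaleCampanato

theorem theorem1p4 {𝕜 : Type*} [RCLike 𝕜] {Ω : Type*} {mΩ : MeasurableSpace Ω}
    (P : Measure Ω) [IsProbabilityMeasure P] (ℱ : Filtration ℕ mΩ)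
    (hgen : ⨆ n, ℱ n = mΩ)
    (hzero : ℱ 0 = ⊥)
    (hatoms : ∀ n, MartingaleCampanato.GeneratedByCountableAtoms (ℱ n) P)
    (hreg : MartingaleCampanato.IsRegular ℱ P)
    (p : ℝ) (hp : 1 ≤ p)
    (φ : ℝ → ℝ) (hφ : ∀ r ∈ Set.Ioc (0 : ℝ) 1, 0 < φ r)
    (hdoubling : MartingaleCampanato.Doubling φ)
    (hint : MartingaleCampanato.IntegralCondition p φ)
    (g : Ω → 𝕜) (hg : Integrable g P) :
    (g ∈ MartingaleCampanato.pointwiseMultipliers 𝕜 mΩ ℱ P p φ →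
      ∀ n, P[g | ℱ n] ∈ MartingaleCampanato.pointwiseMultipliers 𝕜 (ℱ n) ℱ P p φ) ∧
    ((∀ n, P[g | ℱ n] ∈ MartingaleCampanato.pointwiseMultipliers 𝕜 (ℱ n) ℱ P p φ) →
      ⨆ n, MartingaleCampanato.multiplierNorm (ℱ n) ℱ P p φ (P[g | ℱ n]) < ∞ →
      g ∈ MartingaleCampanato.pointwiseMultipliers 𝕜 mΩ ℱ P p φ) := by
  exact ⟨fun hgm n => MartingaleCampanato.condExp_mem_pointwiseMultipliers hp hg hgm n,
    fun hgn hM => MartingaleCampanato.mem_pointwiseMultipliers_of_condExp hgen hzero hp hφ hg hgn hM⟩
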